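/- Let $\mathcal H$ be a real Hilbert space. An operator $T\colon\mathcal H\to\mathcal H$ is nonexpansive if $\|Tx-Ty\|\le\|x-y\|$ for all $x,y\in\mathcal H$. For a nonempty closed convex set $C\subseteq\mathcal H$, let $\Pi_C(x)$ be the unique point of $C$ nearest to $x$. The infimal displacement vector of a nonexpansive $T$ is $\Pi_{\overline{\mathcal R(\mathrm{Id}-T)}}(0)$, where $\mathrm{Id}$ is the identity operator and $\mathcal R(\mathrm{Id}-T)=\{x-Tx : x\in\mathcal H\}$, whose closure is a nonempty closed convex set. Theorem (Interpolability). Let $I$ be a nonempty index set, of arbitrary cardinality, and let $\{(x_i,y_i)\}_{i\in I}\subset\mathcal H\times\mathcal H$ satisfy $\|y_i-y_j\|\le\|x_i-x_j\|$ for all $i,j\in I$. Let $C=\overline{\mathrm{conv}}\,\{x_i-y_i\}_{i\in I}$ be the closure of the convex hull of the vectors $x_i-y_i$. (i) There exists a nonexpansive operator $\widetilde T\colon\mathcal H\to\mathcal H$ such that $y_i=\widetilde T x_i$ for all $i\in I$ and such that $v=\Pi_C(0)$ is the infimal displacement vector of $\widetilde T$. (ii) Let $\star\in I$ and $v=x_\star-y_\star$,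 and assume that $\langle x_i-y_i,\,v\rangle\ge\|v\|^2$ for all $i\in I$. Then there exists a nonexpansive operator $\widetilde T\colon\mathcal H\to\mathcal H$ such that $y_i=\widetilde T x_i$ for all $i\in I$ and such that $v$ is the infimal displacement vector of $\widetilde T$. -/

import Mathlib

/-- A single-valued operator with full domain is nonexpansive. -/
def IsNonexpansive {H : Type*} [NormedAddCommGroup H] (T : H → H) : Prop :=
  ∀ x y : H, ‖T x - T y‖ ≤ ‖x - y‖

/-- `p` is the projection of `x` onto `C`: the unique point of `C` nearest to `x`. -/
def IsProjectionOnto {H : Type*} [NormedAddCommGroup H] (C : Set H) (x p : H) : Prop :=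
  p ∈ C ∧ ∀ z ∈ C, z ≠ p → ‖x - p‖ < ‖x - z‖

/-- `v` is the infimal displacement vector of `T`: the projection of `0` onto the closure of
the range of `I - T`. -/
def IsInfimalDisplacementVector {H : Type*} [NormedAddCommGroup H] (T : H → H) (v : H) : Prop :=
  IsProjectionOnto (closure (Set.range fun x => x - T x)) 0 v

/-- The closed convex hull of the displacements `x i - y i`. -/
def displacementHull {H : Type*} [NormedAddCommGroup H] [InnerProductSpace ℝ H]
    {I : Type*} (x y : I → H) : Set H :=
  closure (convexHull ℝ (Set.range fun i => x i - y i))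

/-! Both parts reduce to a vector `v` in the hull with `‖v‖ ^ 2 ≤ ⟪x i - y i, v⟫` for all `i`: the
projection of `0` in (i), the given displacement in (ii). The data are extended so that every
displacement stays in this half-space. One far point in direction `-v`, with displacement nearly
`v`, is added to the data; a finite Kirszbraun extension must respect it, which forces the bound up
to `ε`. Weak limits along an ultrafilter remove both finiteness and `ε`
(`exists_isNonexpansive_eqOn_inner`). It remains to see that `v` is a limit of displacements of `T`,
not only of their convex combinations. Monotonicity of `I - T` makes the displacements at resolvent
points converge to `v` (`IsNonexpansive.mem_closure_range_sub`). -/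

open Filter Topology

/-! ### Finite Kirszbraun extension -/

section Kirszbraun

variable {H : Type*} [NormedAddCommGroup H] [InnerProductSpace ℝ H]

/-- The variance identity: half the mean squared distance between two independent points. -/
lemma sum_sum_mul_norm_sub_sq {ι : Type*} [Fintype ι] (w : ι → ℝ) (hw : ∑ i, w i = 1)
    (x : ι → H) :
    ∑ i, ∑ j, w i * w j * ‖x i - x j‖ ^ 2 =
      2 * (∑ i, w i * ‖x i‖ ^ 2 - ‖∑ i, w i • x i‖ ^ 2) := by
  have h1 : ‖∑ i, w i • x i‖ ^ 2 = ∑ i, ∑ j, w i * w j * inner ℝ (x i) (x j) := by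
    rw [← real_inner_self_eq_norm_sq, sum_inner]
    refine Finset.sum_congr rfl fun i _ => ?_
    rw [inner_sum]
    refine Finset.sum_congr rfl fun j _ => ?_
    rw [real_inner_smul_left, real_inner_smul_right]; ring
  have h2 : ∑ i, ∑ j, w i * w j * ‖x i‖ ^ 2 = ∑ i, w i * ‖x i‖ ^ 2 := by
    refine Finset.sum_congr rfl fun i _ => ?_
    rw [← Finset.sum_mul, ← Finset.mul_sum, hw, mul_one]
  have h3 : ∑ i, ∑ j, w i * w j * ‖x j‖ ^ 2 = ∑ i, w i * ‖x i‖ ^ 2 := by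
    rw [Finset.sum_comm, ← h2]
    refine Finset.sum_congr rfl fun i _ => Finset.sum_congr rfl fun j _ => ?_
    ring
  have h4 : ∀ i j, w i * w j * ‖x i - x j‖ ^ 2 = w i * w j * ‖x i‖ ^ 2 +
      w i * w j * ‖x j‖ ^ 2 - 2 * (w i * w j * inner ℝ (x i) (x j)) := by
    intro i j
    rw [norm_sub_sq_real]; ring
  simp only [h4, Finset.sum_sub_distrib, Finset.sum_add_distrib, ← Finset.mul_sum] at *
  rw [h1, h2, h3]; ring

/-- Kirszbraun's theorem for finitely many points and one additional point. -/
lemma exists_forall_norm_sub_le {ι : Type*} [Fintype ι] (x y : ι → H)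
    (hxy : ∀ i j, ‖y i - y j‖ ≤ ‖x i - x j‖) (z : H) :
    ∃ w, ∀ i, ‖w - y i‖ ≤ ‖z - x i‖ := by
  classical
  rcases isEmpty_or_nonempty ι with hι | ⟨⟨i₀⟩⟩
  · exact ⟨0, fun i => (hι.false i).elim⟩
  let a : ι → ℝ := fun i => ‖y i‖ ^ 2 - ‖z - x i‖ ^ 2
  -- Dual function of the minimax problem: the minimum over `w` of `∑ μ i * (‖w - y i‖ ^ 2 - ‖z - x
  -- i‖ ^ 2)`, attained at the barycentre of the `y i`.
  let g : (ι → ℝ) → ℝ := fun μ => ∑ i, μ i * a i - ‖∑ i, μ i • y i‖ ^ 2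
  have hg : Continuous g := by fun_prop
  obtain ⟨μ, hμ, hmax⟩ := (isCompact_stdSimplex ℝ ι).exists_isMaxOn
    ⟨_, single_mem_stdSimplex ℝ i₀⟩ hg.continuousOn
  set p := ∑ i, μ i • y i with hp
  have hneg : g μ ≤ 0 := by
    have e1 := sum_sum_mul_norm_sub_sq μ hμ.2 y
    have e2 := sum_sum_mul_norm_sub_sq μ hμ.2 (fun i => z - x i)
    have e3 : ∑ i, ∑ j, μ i * μ j * ‖y i - y j‖ ^ 2 ≤
        ∑ i, ∑ j, μ i * μ j * ‖(z - x i) - (z - x j)‖ ^ 2 := by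
      refine Finset.sum_le_sum fun i _ => Finset.sum_le_sum fun j _ => ?_
      refine mul_le_mul_of_nonneg_left ?_ (mul_nonneg (hμ.1 i) (hμ.1 j))
      rw [sub_sub_sub_cancel_left, norm_sub_rev (x j)]
      exact pow_le_pow_left₀ (norm_nonneg _) (hxy i j) 2
    have e4 : g μ = ∑ i, μ i * ‖y i‖ ^ 2 - ∑ i, μ i * ‖z - x i‖ ^ 2 - ‖p‖ ^ 2 := by
      simp only [g, a, mul_sub, Finset.sum_sub_distrib, hp]
    have e5 := sq_nonneg ‖∑ i, μ i • (z - x i)‖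
    linarith
  refine ⟨p, fun j => ?_⟩
  -- First-order optimality of `μ`, moving towards the vertex `j`.
  have key : ∀ s : ℝ, 0 < s → s ≤ 1 →
      ‖p - y j‖ ^ 2 - ‖z - x j‖ ^ 2 - g μ ≤ s * ‖y j - p‖ ^ 2 := by
    intro s hs hs1
    have hmem : (1 - s) • μ + s • (Pi.single j 1 : ι → ℝ) ∈ stdSimplex ℝ ι :=
      convex_stdSimplex ℝ ι hμ (single_mem_stdSimplex ℝ j) (by linarith) hs.le (by ring)
    have h := hmax hmem
    have f1 : ∑ i, ((1 - s) • μ + s • (Pi.single j 1 : ι → ℝ)) i * a i =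
        (1 - s) * ∑ i, μ i * a i + s * a j := by
      simp [add_mul, Finset.sum_add_distrib, mul_assoc, Finset.mul_sum, Pi.single_apply]
    have f2 : ∑ i, ((1 - s) • μ + s • (Pi.single j 1 : ι → ℝ)) i • y i = p + s • (y j - p) := by
      have : ∑ i, ((1 - s) • μ + s • (Pi.single j 1 : ι → ℝ)) i • y i = (1 - s) • p + s • y j := by
        simp [add_smul, Finset.sum_add_distrib, mul_smul, Finset.smul_sum, Pi.single_apply, hp]
      rw [this]; module
    have f3 : ‖p + s • (y j - p)‖ ^ 2 =
        ‖p‖ ^ 2 + 2 * s * (inner ℝ p (y j) - ‖p‖ ^ 2) + s ^ 2 * ‖y j - p‖ ^ 2 := by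
      rw [norm_add_sq_real, real_inner_smul_right, inner_sub_right, real_inner_self_eq_norm_sq,
        norm_smul, mul_pow, Real.norm_eq_abs, sq_abs]; ring
    have h' : (1 - s) * ∑ i, μ i * a i + s * a j - ‖p + s • (y j - p)‖ ^ 2 ≤ g μ := by
      rw [← f1, ← f2]; exact h
    have hgμ : g μ = ∑ i, μ i * a i - ‖p‖ ^ 2 := rfl
    have ha : a j = ‖y j‖ ^ 2 - ‖z - x j‖ ^ 2 := rfl
    rw [f3] at h'
    rw [norm_sub_sq_real p]
    refine le_of_mul_le_mul_left ?_ hs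
    rw [ha] at h'
    rw [hgμ] at h' ⊢
    linarith
  have hle : ‖p - y j‖ ^ 2 - ‖z - x j‖ ^ 2 - g μ ≤ 0 := by
    have ht : Tendsto (fun s : ℝ => s * ‖y j - p‖ ^ 2) (𝓝[>] 0) (𝓝 0) := by
      have : Tendsto (fun s : ℝ => s * ‖y j - p‖ ^ 2) (𝓝 0) (𝓝 (0 * ‖y j - p‖ ^ 2)) :=
        (continuous_id.mul continuous_const).tendsto 0
      rw [zero_mul] at this
      exact this.mono_left nhdsWithin_le_nhds
    refine ge_of_tendsto ht ?_
    filter_upwards [Ioc_mem_nhdsGT (zero_lt_one' ℝ)] with s hs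
    exact key s hs.1 hs.2
  exact le_of_sq_le_sq (by linarith) (norm_nonneg _)

/-- Kirszbraun's theorem for finitely many points and finitely many additional points. -/
lemma exists_eqOn_norm_sub_le [DecidableEq H] (s u : Finset H) (f : H → H)
    (hf : ∀ a ∈ s, ∀ b ∈ s, ‖f a - f b‖ ≤ ‖a - b‖) :
    ∃ g : H → H, (∀ a ∈ s, g a = f a) ∧
      ∀ a ∈ s ∪ u, ∀ b ∈ s ∪ u, ‖g a - g b‖ ≤ ‖a - b‖ := by
  induction u using Finset.induction_on with
  | empty => exact ⟨f, fun _ _ => rfl, by simpa using hf⟩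
  | insert p u _ ih =>
    obtain ⟨g, hg, hgn⟩ := ih
    obtain ⟨w, hw⟩ := exists_forall_norm_sub_le (ι := (s ∪ u : Finset H)) (fun a => (a : H))
      (fun a => g a) (fun a b => hgn a a.2 b b.2) p
    have hval : ∀ a ∈ s ∪ u, Function.update g p w a = g a := by
      intro a ha
      rcases eq_or_ne a p with rfl | hne
      · have := hw ⟨a, ha⟩
        rw [sub_self, norm_zero] at this
        simpa [sub_eq_zero] using this
      · simp [hne]
    refine ⟨Function.update g p w, fun a ha => ?_, ?_⟩
    · rw [hval a (Finset.mem_union_left _ ha), hg a ha]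
    · rw [Finset.union_insert]
      intro a ha b hb
      rcases Finset.mem_insert.1 ha with rfl | ha' <;>
        rcases Finset.mem_insert.1 hb with rfl | hb'
      · simp
      · rw [hval b hb', Function.update_self]; exact hw ⟨b, hb'⟩
      · rw [hval a ha', Function.update_self, norm_sub_rev, norm_sub_rev a]; exact hw ⟨a, ha'⟩
      · rw [hval a ha', hval b hb']; exact hgn a ha' b hb'

/-- A finite nonexpansive extension whose displacements almost stay in the half-space
`‖v‖ ^ 2 ≤ ⟪·, v⟫`. -/
lemma exists_eqOn_norm_sub_le_inner [DecidableEq H] (s u : Finset H) (f : H → H)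
    (hf : ∀ a ∈ s, ∀ b ∈ s, ‖f a - f b‖ ≤ ‖a - b‖) (v : H)
    (hv : ∀ a ∈ s, ‖v‖ ^ 2 ≤ inner ℝ (a - f a) v) {ε : ℝ} (hε : 0 < ε) :
    ∃ g : H → H, (∀ a ∈ s, g a = f a) ∧
      (∀ a ∈ s ∪ u, ∀ b ∈ s ∪ u, ‖g a - g b‖ ≤ ‖a - b‖) ∧
      ∀ a ∈ s ∪ u, ‖v‖ ^ 2 - ε ≤ inner ℝ (a - g a) v := by
  rcases eq_or_ne v 0 with rfl | hv0
  · obtain ⟨g, hg, hgn⟩ := exists_eqOn_norm_sub_le s u f hf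
    exact ⟨g, hg, hgn, fun a _ => by simpa using hε.le⟩
  have hvpos : 0 < ‖v‖ ^ 2 := by positivity
  obtain ⟨c, hc⟩ : ∃ c : ℝ, c * ‖v‖ ^ 2 = ‖v‖ ^ 2 - ε / 2 :=
    ⟨(‖v‖ ^ 2 - ε / 2) / ‖v‖ ^ 2, div_mul_cancel₀ _ hvpos.ne'⟩
  have hbig : ∀ r : ℝ, ∀ᶠ t : ℝ in atTop, r ≤ t * ε := fun r =>
    (tendsto_id.atTop_mul_const hε).eventually_ge_atTop r
  have h1 : ∀ᶠ t : ℝ in atTop, ∀ a ∈ s, ‖f a + c • v‖ ^ 2 ≤ t * ε :=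
    (eventually_all_finset s).2 fun a _ => hbig _
  have h2 : ∀ᶠ t : ℝ in atTop, ∀ a ∈ s ∪ u, ‖a‖ ^ 2 ≤ t * ε :=
    (eventually_all_finset _).2 fun a _ => hbig _
  -- With `p - q = c • v`, the `t ^ 2` terms of the squared distances to `p` and `q` cancel and the
  -- terms linear in `t` compare `⟪a - f a, v⟫` with `‖v‖ ^ 2 - ε / 2`. The slack `t * ε` absorbs
  -- the bounded terms, both in adding the pair and in reading off the conclusion.
  obtain ⟨t, ht1, ht2, ht⟩ := (h1.and (h2.and (eventually_gt_atTop 0))).exists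
  set p : H := -(t • v) with hp
  set q : H := -(c • v) - t • v with hq
  have exz : ∀ a : H, ‖a - p‖ ^ 2 = ‖a‖ ^ 2 + 2 * t * inner ℝ a v + ‖t • v‖ ^ 2 := by
    intro a
    rw [hp, sub_neg_eq_add, norm_add_sq_real, real_inner_smul_right]; ring
  have exw : ∀ w : H, ‖w - q‖ ^ 2 = ‖w + c • v‖ ^ 2 +
      2 * t * (inner ℝ w v + ‖v‖ ^ 2 - ε / 2) + ‖t • v‖ ^ 2 := by
    intro w
    rw [show w - q = (w + c • v) + t • v by rw [hq]; abel, norm_add_sq_real (w + c • v),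
      real_inner_smul_right, inner_add_left, real_inner_smul_left, real_inner_self_eq_norm_sq, hc]
    ring
  have hsp : ∀ a ∈ s, ‖f a - q‖ ≤ ‖a - p‖ := by
    intro a ha
    refine le_of_sq_le_sq ?_ (norm_nonneg _)
    rw [exz, exw]
    have h := hv a ha
    rw [inner_sub_left] at h
    have := mul_le_mul_of_nonneg_left h ht.le
    linarith [ht1 a ha, sq_nonneg ‖a‖]
  have hval : ∀ a ∈ s, Function.update f p q a = f a := by
    intro a ha
    rcases eq_or_ne a p with rfl | hne
    · have := hsp _ ha
      rw [sub_self, norm_zero] at this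
      simpa [sub_eq_zero, eq_comm] using this
    · simp [hne]
  obtain ⟨g, hg, hgn⟩ := exists_eqOn_norm_sub_le (insert p s) u (Function.update f p q) (by
    intro a ha b hb
    rcases Finset.mem_insert.1 ha with rfl | ha' <;>
      rcases Finset.mem_insert.1 hb with rfl | hb'
    · simp
    · rw [hval b hb', Function.update_self, norm_sub_rev, norm_sub_rev _ b]; exact hsp b hb'
    · rw [hval a ha', Function.update_self]; exact hsp a ha'
    · rw [hval a ha', hval b hb']; exact hf a ha' b hb')
  have hsub : ∀ a ∈ s ∪ u, a ∈ insert p s ∪ u := fun a ha =>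
    Finset.union_subset_union_left (Finset.subset_insert _ _) ha
  refine ⟨g, fun a ha => ?_, fun a ha b hb => hgn a (hsub a ha) b (hsub b hb), fun a ha => ?_⟩
  · rw [hg a (Finset.mem_insert_of_mem ha), hval a ha]
  · have h := hgn a (hsub a ha) p (Finset.mem_union_left _ (Finset.mem_insert_self _ _))
    rw [hg p (Finset.mem_insert_self _ _), Function.update_self] at h
    have h' := pow_le_pow_left₀ (norm_nonneg _) h 2
    rw [exz, exw] at h'
    have h3 := sq_nonneg ‖g a + c • v‖
    have h4 := ht2 a ha
    rw [inner_sub_left]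
    refine le_of_mul_le_mul_left ?_ ht
    linarith

end Kirszbraun

/-! ### Weak limits and extension to the whole space -/

section WeakLimits

variable {H : Type*} [NormedAddCommGroup H] [InnerProductSpace ℝ H]

/-- Bounded families in a Hilbert space converge weakly along ultrafilters. -/
lemma Ultrafilter.exists_weak_limit [CompleteSpace H] {α : Type*} (U : Ultrafilter α) (a : α → H)
    (R : ℝ) (h : ∀ᶠ i in (U : Filter α), ‖a i‖ ≤ R) :
    ∃ L : H, ∀ z, Tendsto (fun i => inner ℝ (a i) z) U (𝓝 (inner ℝ L z)) := by
  let f : α → WeakDual ℝ H := fun i =>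
    WeakDual.toStrongDual.symm (InnerProductSpace.toDual ℝ H (a i))
  have hle : ((U.map f : Ultrafilter _) : Filter (WeakDual ℝ H)) ≤
      𝓟 (WeakDual.toStrongDual ⁻¹' Metric.closedBall (0 : StrongDual ℝ H) R) := by
    rw [le_principal_iff, Ultrafilter.mem_coe, Ultrafilter.mem_map, ← Ultrafilter.mem_coe]
    filter_upwards [h] with i hi
    simpa [f] using hi
  obtain ⟨ψ, -, hψ⟩ := (WeakDual.isCompact_closedBall (0 : StrongDual ℝ H) R).ultrafilter_le_nhds
    (U.map f) hle
  refine ⟨(InnerProductSpace.toDual ℝ H).symm (WeakDual.toStrongDual ψ), fun z => ?_⟩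
  rw [InnerProductSpace.toDual_symm_apply]
  exact ((WeakDual.eval_continuous z).tendsto ψ).comp (show Tendsto f U (𝓝 ψ) from hψ)

lemma norm_le_of_weak_limit {α : Type*} {l : Filter α} [l.NeBot] {a : α → H} {L : H}
    (h : ∀ z, Tendsto (fun i => inner ℝ (a i) z) l (𝓝 (inner ℝ L z))) {c : ℝ}
    (hc : ∀ᶠ i in l, ‖a i‖ ≤ c) : ‖L‖ ≤ c := by
  have h1 : inner ℝ L L ≤ c * ‖L‖ := by
    refine le_of_tendsto (h L) ?_
    filter_upwards [hc] with i hi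
    exact (real_inner_le_norm _ _).trans (mul_le_mul_of_nonneg_right hi (norm_nonneg _))
  rw [real_inner_self_eq_norm_mul_norm] at h1
  rcases (norm_nonneg L).eq_or_lt with h0 | h0
  · obtain ⟨i, hi⟩ := hc.exists
    exact h0 ▸ (norm_nonneg _).trans hi
  · exact le_of_mul_le_mul_right h1 h0

/-- Kirszbraun's theorem with displacements in the half-space `‖v‖ ^ 2 ≤ ⟪·, v⟫`. -/
theorem exists_isNonexpansive_eqOn_inner [CompleteSpace H] (D : Set H) (hD : D.Nonempty)
    (f : H → H) (hf : ∀ a ∈ D, ∀ b ∈ D, ‖f a - f b‖ ≤ ‖a - b‖) (v : H)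
    (hv : ∀ a ∈ D, ‖v‖ ^ 2 ≤ inner ℝ (a - f a) v) :
    ∃ T : H → H, IsNonexpansive T ∧ (∀ a ∈ D, T a = f a) ∧
      ∀ a, ‖v‖ ^ 2 ≤ inner ℝ (a - T a) v := by
  classical
  have key : ∀ k : Finset H × ℕ, ∃ g : H → H, (∀ a ∈ k.1, a ∈ D → g a = f a) ∧
      (∀ a ∈ k.1, ∀ b ∈ k.1, ‖g a - g b‖ ≤ ‖a - b‖) ∧
      ∀ a ∈ k.1, ‖v‖ ^ 2 - 1 / ((k.2 : ℝ) + 1) ≤ inner ℝ (a - g a) v := by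
    rintro ⟨F, n⟩
    obtain ⟨g, h1, h2, h3⟩ := exists_eqOn_norm_sub_le_inner (F.filter (· ∈ D)) F f
      (fun a ha b hb => hf a (Finset.mem_filter.1 ha).2 b (Finset.mem_filter.1 hb).2) v
      (fun a ha => hv a (Finset.mem_filter.1 ha).2) (Nat.one_div_pos_of_nat (α := ℝ) (n := n))
    exact ⟨g, fun a ha haD => h1 a (Finset.mem_filter.2 ⟨ha, haD⟩),
      fun a ha b hb => h2 a (Finset.mem_union_right _ ha) b (Finset.mem_union_right _ hb),
      fun a ha => h3 a (Finset.mem_union_right _ ha)⟩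
  choose G hGf hGn hGv using key
  -- Along `U` every point is eventually in the finite set and the error tends to zero.
  let U : Ultrafilter (Finset H × ℕ) := Ultrafilter.of atTop
  have hU : (U : Filter (Finset H × ℕ)) ≤ atTop := Ultrafilter.of_le _
  have hmem : ∀ a : H, ∀ᶠ k in (U : Filter (Finset H × ℕ)), a ∈ k.1 := by
    intro a
    filter_upwards [hU (eventually_ge_atTop (({a} : Finset H), 0))] with k hk
    exact hk.1 (Finset.mem_singleton_self a)
  obtain ⟨o, ho⟩ := hD
  have hlim : ∀ a : H, ∃ L : H, ∀ z,
      Tendsto (fun k => inner ℝ (G k a) z) U (𝓝 (inner ℝ L z)) := by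
    intro a
    refine U.exists_weak_limit (fun k => G k a) (‖a - o‖ + ‖f o‖) ?_
    filter_upwards [hmem a, hmem o] with k ha hko
    have h := hGn k a ha o hko
    rw [hGf k o hko ho] at h
    linarith [norm_le_norm_sub_add (G k a) (f o)]
  choose T hT using hlim
  refine ⟨T, fun a b => ?_, fun a ha => ?_, fun a => ?_⟩
  · refine norm_le_of_weak_limit (l := (U : Filter (Finset H × ℕ))) (a := fun k => G k a - G k b)
      (fun z => ?_) ?_
    · simp only [inner_sub_left]
      exact (hT a z).sub (hT b z)
    · filter_upwards [hmem a, hmem b] with k hka hkb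
      exact hGn k a hka b hkb
  · refine ext_inner_right ℝ fun z => tendsto_nhds_unique (hT a z) ?_
    refine tendsto_const_nhds.congr' ?_
    filter_upwards [hmem a] with k hka
    rw [hGf k a hka ha]
  · have h1 : Tendsto (fun k : Finset H × ℕ => ‖v‖ ^ 2 - 1 / ((k.2 : ℝ) + 1)) U
        (𝓝 (‖v‖ ^ 2 - 0)) := by
      refine tendsto_const_nhds.sub (tendsto_one_div_add_atTop_nhds_zero_nat.comp ?_)
      refine Tendsto.mono_left ?_ hU
      rw [← prod_atTop_atTop_eq]
      exact tendsto_snd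
    have h2 : Tendsto (fun k => inner ℝ (a - G k a) v) U (𝓝 (inner ℝ (a - T a) v)) := by
      simp only [inner_sub_left]
      exact tendsto_const_nhds.sub (hT a v)
    rw [sub_zero] at h1
    refine le_of_tendsto_of_tendsto h1 h2 ?_
    filter_upwards [hmem a] with k hka
    exact hGv k a hka

end WeakLimits

/-! ### Range of `I - T` -/

section Displacement

variable {H : Type*} [NormedAddCommGroup H] [InnerProductSpace ℝ H]

lemma IsNonexpansive.inner_sub_nonneg {T : H → H} (hT : IsNonexpansive T) (a b : H) :
    0 ≤ inner ℝ ((a - T a) - (b - T b)) (a - b) := by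
  have h1 : (a - T a) - (b - T b) = (a - b) - (T a - T b) := by abel
  rw [h1, inner_sub_left, real_inner_self_eq_norm_mul_norm]
  have h2 := real_inner_le_norm (T a - T b) (a - b)
  have h3 := mul_le_mul_of_nonneg_right (hT a b) (norm_nonneg (a - b))
  linarith

/-- Such an `x` is the fixed point of the contraction `(1 + r)⁻¹ • T`. -/
lemma IsNonexpansive.exists_sub_eq_neg_smul [CompleteSpace H] {T : H → H}
    (hT : IsNonexpansive T) {r : ℝ} (hr : 0 < r) : ∃ x, x - T x = -(r • x) := by
  have h1 : 0 < 1 + r := by linarith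
  have hc : ContractingWith ⟨(1 + r)⁻¹, (inv_pos.2 h1).le⟩ (fun x => (1 + r)⁻¹ • T x) := by
    refine ⟨?_, LipschitzWith.of_dist_le_mul fun a b => ?_⟩
    · exact NNReal.coe_lt_coe.1 <| show (1 + r)⁻¹ < 1 from inv_lt_one_of_one_lt₀ (by linarith)
    · rw [dist_eq_norm, dist_eq_norm, ← smul_sub, norm_smul, Real.norm_eq_abs,
        abs_of_pos (inv_pos.2 h1)]
      exact mul_le_mul_of_nonneg_left (hT a b) (inv_pos.2 h1).le
  have hfix : (1 + r)⁻¹ • T (hc.fixedPoint _) = hc.fixedPoint _ := hc.fixedPoint_isFixedPt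
  refine ⟨hc.fixedPoint _, ?_⟩
  rw [inv_smul_eq_iff₀ h1.ne'] at hfix
  rw [hfix]; module

/-- An element of the closed convex hull of the displacements which is minimal in the sense of the
variational inequality belongs to the closure of the displacements. -/
theorem IsNonexpansive.mem_closure_range_sub [CompleteSpace H] {T : H → H}
    (hT : IsNonexpansive T) {v : H} (hv : ∀ a, ‖v‖ ^ 2 ≤ inner ℝ (a - T a) v)
    (hmem : v ∈ closure (convexHull ℝ (Set.range fun x => x - T x))) :
    v ∈ closure (Set.range fun x => x - T x) := by
  have hr : ∀ n : ℕ, 0 < 1 / ((n : ℝ) + 1) := fun n => Nat.one_div_pos_of_nat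
  choose x hx using fun n => hT.exists_sub_eq_neg_smul (hr n)
  let w : ℕ → H := fun n => x n - T (x n)
  -- Monotonicity of `I - T` at `a` and `x n`, scaled so that `x n` becomes `-w n`.
  have hmono : ∀ a n, ‖w n‖ ^ 2 ≤
      inner ℝ (a - T a) (w n) + 1 / ((n : ℝ) + 1) * inner ℝ (a - T a - w n) a := by
    intro a n
    have h := mul_nonneg (hr n).le (hT.inner_sub_nonneg a (x n))
    have e : (1 / ((n : ℝ) + 1)) • (a - x n) = (1 / ((n : ℝ) + 1)) • a + w n := by
      simp only [w, hx n, smul_sub]; abel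
    rw [← real_inner_smul_right, e, inner_add_right, real_inner_smul_right] at h
    have e2 : inner ℝ (a - T a - w n) (w n) = inner ℝ (a - T a) (w n) - ‖w n‖ ^ 2 := by
      rw [inner_sub_left, real_inner_self_eq_norm_sq]
    change 0 ≤ 1 / ((n : ℝ) + 1) * inner ℝ (a - T a - w n) a +
      inner ℝ (a - T a - w n) (w n) at h
    linarith
  have hbdd : ∀ n, ‖w n‖ ≤ ‖0 - T 0‖ := by
    intro n
    have h := hmono 0 n
    rw [inner_zero_right, mul_zero, add_zero] at h
    have h2 := h.trans (real_inner_le_norm _ _)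
    rcases (norm_nonneg (w n)).eq_or_lt with h0 | h0
    · rw [← h0]; exact norm_nonneg _
    · exact le_of_mul_le_mul_right (by rwa [sq] at h2) h0
  set B := ‖0 - T 0‖
  have hB : 0 ≤ B := norm_nonneg _
  -- An asymptotic variational inequality, affine in `z` and stable under limits as `w` is bounded,
  -- so it passes from displacements to their closed convex hull.
  let S : Set H := {z | ∀ ε > 0, ∀ᶠ n in atTop, ‖w n‖ ^ 2 ≤ inner ℝ z (w n) + ε}
  have hS1 : (Set.range fun a => a - T a) ⊆ S := by
    rintro _ ⟨a, rfl⟩ ε hε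
    have ht : Tendsto (fun n : ℕ => 1 / ((n : ℝ) + 1) * ((‖a - T a‖ + B) * ‖a‖)) atTop (𝓝 0) := by
      simpa only [zero_mul] using
        tendsto_one_div_add_atTop_nhds_zero_nat.mul_const ((‖a - T a‖ + B) * ‖a‖)
    filter_upwards [ht.eventually_lt_const hε] with n hn
    have h1 : inner ℝ (a - T a - w n) a ≤ (‖a - T a‖ + B) * ‖a‖ :=
      (real_inner_le_norm _ _).trans (mul_le_mul_of_nonneg_right
        ((norm_sub_le _ _).trans (by linarith [hbdd n])) (norm_nonneg _))
    have h2 := mul_le_mul_of_nonneg_left h1 (hr n).le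
    linarith [hmono a n]
  have hS2 : Convex ℝ S := by
    intro z₁ h₁ z₂ h₂ s t hs ht hst ε hε
    filter_upwards [h₁ ε hε, h₂ ε hε] with n hn₁ hn₂
    rw [inner_add_left, real_inner_smul_left, real_inner_smul_left]
    have h3 := mul_le_mul_of_nonneg_left hn₁ hs
    have h4 := mul_le_mul_of_nonneg_left hn₂ ht
    obtain rfl : t = 1 - s := by linarith
    linarith
  have hS3 : IsClosed S := by
    refine isClosed_of_closure_subset fun z hz ε hε => ?_
    obtain ⟨z', hz', hd⟩ := Metric.mem_closure_iff.1 hz (ε / (2 * (B + 1))) (by positivity)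
    filter_upwards [hz' (ε / 2) (by positivity)] with n hn
    have h1 : inner ℝ (z' - z) (w n) ≤ ε / 2 := by
      rw [dist_comm, dist_eq_norm, lt_div_iff₀ (by positivity)] at hd
      have h2 := real_inner_le_norm (z' - z) (w n)
      have h3 := mul_le_mul_of_nonneg_left ((hbdd n).trans (le_add_of_nonneg_right zero_le_one))
        (norm_nonneg (z' - z))
      linarith
    rw [inner_sub_left] at h1
    linarith
  have hvS : v ∈ S := closure_minimal (convexHull_min hS1 hS2) hS3 hmem
  -- Membership in `S` bounds `‖w n‖ ^ 2` by `⟪v, w n⟫` plus an error, and `hv` gives `‖v‖ ^ 2 ≤ ⟪w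
  -- n, v⟫`; expanding `‖v - w n‖ ^ 2` leaves only the error.
  refine Metric.mem_closure_iff.2 fun ε hε => ?_
  obtain ⟨n, hn⟩ := (hvS (ε ^ 2 / 2) (by positivity)).exists
  refine ⟨w n, ⟨x n, rfl⟩, ?_⟩
  rw [dist_eq_norm]
  refine lt_of_pow_lt_pow_left₀ 2 hε.le ?_
  have h1 : ‖v‖ ^ 2 ≤ inner ℝ (w n) v := hv (x n)
  rw [real_inner_comm] at h1
  rw [norm_sub_sq_real]
  have : 0 < ε ^ 2 := by positivity
  linarith

/-! ### Variational inequality and interpolation -/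

lemma isProjectionOnto_zero {C : Set H} {v : H} (hv : v ∈ C)
    (h : ∀ z ∈ C, ‖v‖ ^ 2 ≤ inner ℝ z v) : IsProjectionOnto C 0 v := by
  refine ⟨hv, fun z hz hne => ?_⟩
  rw [zero_sub, zero_sub, norm_neg, norm_neg]
  refine lt_of_pow_lt_pow_left₀ 2 (norm_nonneg _) ?_
  have h1 : 0 < ‖z - v‖ ^ 2 := by
    have := norm_pos_iff.2 (sub_ne_zero.2 hne)
    positivity
  rw [norm_sub_sq_real] at h1
  linarith [h z hz]

lemma isClosed_setOf_norm_sq_le_inner (v : H) : IsClosed {z : H | ‖v‖ ^ 2 ≤ inner ℝ z v} :=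
  isClosed_le continuous_const (by fun_prop)

/-- Nonexpansive data extend to an operator whose infimal displacement vector is a given `v` in
the closed convex hull of the displacements satisfying the variational inequality. -/
theorem exists_isNonexpansive_isInfimalDisplacementVector [CompleteSpace H] {I : Type*} [Nonempty I]
    (x y : I → H) (hxy : ∀ i j, ‖y i - y j‖ ≤ ‖x i - x j‖) {v : H}
    (hmem : v ∈ displacementHull x y) (hv : ∀ i, ‖v‖ ^ 2 ≤ inner ℝ (x i - y i) v) :
    ∃ T : H → H, IsNonexpansive T ∧ (∀ i, T (x i) = y i) ∧ IsInfimalDisplacementVector T v := by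
  -- Repeated nodes carry equal values, so the data define a function.
  have hfac : y.FactorsThrough x := fun i j hij => by
    have := hxy i j
    rw [hij, sub_self, norm_zero] at this
    simpa [sub_eq_zero] using this
  let f : H → H := Function.extend x y 0
  have hf : ∀ i, f (x i) = y i := fun i => hfac.extend_apply 0 i
  obtain ⟨T, hT, hTf, hTv⟩ := exists_isNonexpansive_eqOn_inner (Set.range x)
    (Set.range_nonempty x) f
    (by rintro _ ⟨i, rfl⟩ _ ⟨j, rfl⟩; rw [hf, hf]; exact hxy i j) v
    (by rintro _ ⟨i, rfl⟩; rw [hf]; exact hv i)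
  have hTx : ∀ i, T (x i) = y i := fun i => (hTf _ ⟨i, rfl⟩).trans (hf i)
  refine ⟨T, hT, hTx, isProjectionOnto_zero (hT.mem_closure_range_sub hTv ?_) ?_⟩
  · refine closure_mono (convexHull_mono ?_) hmem
    rintro _ ⟨i, rfl⟩
    exact ⟨x i, by simp only [hTx]⟩
  · refine closure_minimal ?_ (isClosed_setOf_norm_sq_le_inner v)
    rintro _ ⟨a, rfl⟩
    exact hTv a

/-- A nonempty closed convex set has an element satisfying the variational inequality of the
projection of `0`. -/
lemma exists_mem_forall_norm_sq_le_inner [CompleteSpace H] {C : Set H} (hne : C.Nonempty)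
    (hcl : IsClosed C) (hconv : Convex ℝ C) : ∃ v ∈ C, ∀ z ∈ C, ‖v‖ ^ 2 ≤ inner ℝ z v := by
  obtain ⟨v, hvC, hmin⟩ := exists_norm_eq_iInf_of_complete_convex hne hcl.isComplete hconv 0
  refine ⟨v, hvC, fun z hz => ?_⟩
  have h := (norm_eq_iInf_iff_real_inner_le_zero hconv hvC).1 hmin z hz
  rw [zero_sub, inner_neg_left, inner_sub_right, real_inner_self_eq_norm_sq, real_inner_comm] at h
  linarith

end Displacement

theorem mainTheorem7 {H : Type*} [NormedAddCommGroup H] [InnerProductSpace ℝ H] [CompleteSpace H]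
    {I : Type*} [Nonempty I] (x y : I → H)
    (hxy : ∀ i j : I, ‖y i - y j‖ ≤ ‖x i - x j‖) :
    (∃ v : H, IsProjectionOnto (displacementHull x y) 0 v ∧
      ∃ T : H → H, IsNonexpansive T ∧ (∀ i : I, T (x i) = y i) ∧
        IsInfimalDisplacementVector T v) ∧
    (∀ (s : I) (v : H), v = x s - y s → (∀ i : I, ‖v‖ ^ 2 ≤ inner ℝ (x i - y i) v) →
      ∃ T : H → H, IsNonexpansive T ∧ (∀ i : I, T (x i) = y i) ∧
        IsInfimalDisplacementVector T v) := by
  have hsub : ∀ i, x i - y i ∈ displacementHull x y := fun i =>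
    subset_closure (subset_convexHull ℝ _ ⟨i, rfl⟩)
  constructor
  · obtain ⟨v, hvC, hv⟩ := exists_mem_forall_norm_sq_le_inner (C := displacementHull x y)
      ((Set.range_nonempty _).convexHull.closure) isClosed_closure (convex_convexHull ℝ _).closure
    exact ⟨v, isProjectionOnto_zero hvC hv, exists_isNonexpansive_isInfimalDisplacementVector x y
      hxy hvC fun i => hv _ (hsub i)⟩
  · rintro s v rfl hv
    exact exists_isNonexpansive_isInfimalDisplacementVector x y hxy (hsub s) hv
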